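/- A stochastic game $G$ has a finite state set $S = S_\Diamond \sqcup S_\Box$ (states of the controller $\Diamond$ and of the environment $\Box$), an initial state $\bar s$, a finite action set $A$, and a partial transition function $\delta : S\times A \rightharpoonup \mathrm{Dist}(S)$ with rational probabilities; $A(s)=\{a : \delta(s,a)\text{ is defined}\}$. A (memoryless) strategy $\sigma$ of $\Diamond$ (resp. $\pi$ of $\Box$) assigns to each of that player's states $s$ a distribution on $A(s)$. For $r : S\times A\to\mathbb{Q}_{\ge 0}$, $E^{\sigma,\pi}_{s}(r)$ is the expected total reward $\sum_{j\ge 0} r(s_j,a_j)$ over the infinite random path $s_0a_0s_1a_1\dots$ from $s_0=s$ induced by $\sigma,\pi$. It is assumed that $\sup_{\sigma,\pi}E^{\sigma,\pi}_{s}(r)<\infty$ for every $s\in S$. A (memoryless) multi-strategy $\theta$ assigns to each $s\in S_\Diamond$ a distribution $\theta(s)$ on the non-empty subsets of $A(s)$. A strategy $\sigma$ of $\Diamond$ complies with $\theta$ if for all $s\in S_\Diamond$ and $\emptyset\ne C\subseteq A(s)$ there are distributions $d_{s,C}$ on $C$ with $\sigma(s)(a)=\sum_{C\ni a}\theta(s)(C)\,d_{s,C}(a)$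 for all $a\in A(s)$. For a bound $b\in\mathbb{R}$, $\theta$ is sound if $E^{\sigma,\pi}_{\bar s}(r)\ge b$ for all $\sigma$ complying with $\theta$ and all strategies $\pi$ of $\Box$. For a penalty function $\psi:S_\Diamond\times A\to\mathbb{Q}_{\ge 0}$, the static penalty of $\theta$ is $$\mathrm{pen}_{\mathrm{sta}}(\psi,\theta)=\sum_{s\in S_\Diamond}\ \sum_{C\subseteq A(s)}\ \sum_{a\in A(s)\setminus C}\theta(s)(C)\,\psi(s,a).$$ Theorem. For every such $G$, $r$, $b$, $\psi$ and every sound multi-strategy $\theta$ there is a sound multi-strategy $\theta'$ with $\mathrm{pen}_{\mathrm{sta}}(\psi,\theta')\le \mathrm{pen}_{\mathrm{sta}}(\psi,\theta)$ such that, for every $s\in S_\Diamond$, $\theta'(s)$ gives positive probability to at most two sets, and any two sets $B,C$ of positive probability under $\theta'(s)$ satisfy $B\subseteq C$ or $C\subseteq B$. -/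

import Mathlib

open MeasureTheory ProbabilityTheory
open scoped NNReal ENNReal NNRat

/-- A finite turn-based stochastic two-player game. Its states are the elements of `D ⊕ B`: those
in `D` belong to player diamond (the controller), those in `B` to player box (the environment).
The transition function is partial: `trans s a = none` means that `a` is not enabled in `s`. All
transition probabilities are rational. -/
structure StochasticGame (D B A : Type*) [Fintype D] [Fintype B] [Fintype A] where
  init : D ⊕ B
  trans : D ⊕ B → A → Option (PMF (D ⊕ B))
  rational : ∀ s a μ t, trans s a = some μ → ∃ q : ℚ≥0, μ t = ((q : ℝ≥0) : ℝ≥0∞)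

/-- A step `(s, a)` of a path: the current state and the action that is taken in it. -/
def Step (S A : Type*) : Type _ := S × A

instance (S A : Type*) : MeasurableSpace (Step S A) := ⊤

instance (S A : Type*) : DiscreteMeasurableSpace (Step S A) := ⟨fun _ => trivial⟩

instance (S A : Type*) [Finite S] [Finite A] : Finite (Step S A) :=
  inferInstanceAs (Finite (S × A))

namespace StochasticGame

variable {D B A : Type*} [Fintype D] [Fintype B] [Fintype A]

/-- The set `A(s)` of actions that are enabled in the state `s`. -/
def enabled (G : StochasticGame D B A) (s : D ⊕ B) : Finset A :=
  Finset.univ.filter fun a => (G.trans s a).isSome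

/-- A memoryless (possibly randomised) strategy of player diamond. -/
structure DiamondStrategy (G : StochasticGame D B A) where
  choose : D → PMF A
  mem_enabled : ∀ s, ∀ a ∈ (choose s).support, a ∈ G.enabled (Sum.inl s)

/-- A memoryless (possibly randomised) strategy of player box. -/
structure BoxStrategy (G : StochasticGame D B A) where
  choose : B → PMF A
  mem_enabled : ∀ s, ∀ a ∈ (choose s).support, a ∈ G.enabled (Sum.inr s)

/-- The distribution of the action taken in each state when the two players use `σ` and `π`. -/
def actionDist {G : StochasticGame D B A} (σ : G.DiamondStrategy) (π : G.BoxStrategy) :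
    D ⊕ B → PMF A :=
  Sum.elim σ.choose π.choose

/-- The distribution of the successor state. The default value is never used under a pair of
strategies, since these only choose enabled actions. -/
noncomputable def next (G : StochasticGame D B A) (s : D ⊕ B) (a : A) : PMF (D ⊕ B) :=
  (G.trans s a).getD (PMF.pure s)

/-- The distribution of the step taken in the state `s`. -/
noncomputable def stepFrom {G : StochasticGame D B A} (σ : G.DiamondStrategy) (π : G.BoxStrategy)
    (s : D ⊕ B) : PMF (Step (D ⊕ B) A) :=
  (actionDist σ π s).map fun a => (s, a)

/-- The distribution of the step that follows a given step. -/
noncomputable def stepAfter {G : StochasticGame D B A} (σ : G.DiamondStrategy) (π : G.BoxStrategy)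
    (x : Step (D ⊕ B) A) : PMF (Step (D ⊕ B) A) :=
  (G.next x.1 x.2).bind (stepFrom σ π)

/-- The Markov kernel that sends a history of `n + 1` steps to the law of the next step. -/
noncomputable def stepKernel {G : StochasticGame D B A} (σ : G.DiamondStrategy)
    (π : G.BoxStrategy) (n : ℕ) :
    Kernel ((i : Finset.Iic n) → (fun _ : ℕ => Step (D ⊕ B) A) i) (Step (D ⊕ B) A) :=
  (Kernel.ofFunOfCountable fun x => (stepAfter σ π x).toMeasure).comap
    (fun h => h ⟨n, Finset.mem_Iic.2 le_rfl⟩) (measurable_pi_apply _)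

instance {G : StochasticGame D B A} (σ : G.DiamondStrategy) (π : G.BoxStrategy) (n : ℕ) :
    IsMarkovKernel (stepKernel σ π n) :=
  ⟨fun h => inferInstanceAs
    (IsProbabilityMeasure (stepAfter σ π (h ⟨n, Finset.mem_Iic.2 le_rfl⟩)).toMeasure)⟩

/-- The probability measure on infinite paths `s₀ a₀ s₁ a₁ …` with `s₀ = s` that is induced by
the strategies `σ` and `π`. -/
noncomputable def pathMeasure {G : StochasticGame D B A} (σ : G.DiamondStrategy)
    (π : G.BoxStrategy) (s : D ⊕ B) : Measure (ℕ → Step (D ⊕ B) A) :=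
  Kernel.trajMeasure (X := fun _ => Step (D ⊕ B) A) (stepFrom σ π s).toMeasure (stepKernel σ π)

/-- The total reward `∑ⱼ r(sⱼ, aⱼ)` accumulated along an infinite path. -/
noncomputable def totalReward (r : D ⊕ B → A → ℚ≥0) (ω : ℕ → Step (D ⊕ B) A) : ℝ≥0∞ :=
  ∑' j, ((r (ω j).1 (ω j).2 : ℝ≥0) : ℝ≥0∞)

/-- The expected total reward from the state `s` under the strategies `σ` and `π`. -/
noncomputable def expectedReward {G : StochasticGame D B A} (r : D ⊕ B → A → ℚ≥0)
    (σ : G.DiamondStrategy) (π : G.BoxStrategy) (s : D ⊕ B) : ℝ≥0∞ :=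
  ∫⁻ ω, totalReward r ω ∂(pathMeasure σ π s)

/-- The maximum possible expected total reward is finite, from every state. -/
def FiniteMaxReward (G : StochasticGame D B A) (r : D ⊕ B → A → ℚ≥0) : Prop :=
  ∀ s, (⨆ (σ : G.DiamondStrategy) (π : G.BoxStrategy), expectedReward r σ π s) < ∞

/-- `σ` is sound for the property "the expected total reward for `r` is at least `b`". -/
def DiamondStrategy.Sound {G : StochasticGame D B A} (σ : G.DiamondStrategy)
    (r : D ⊕ B → A → ℚ≥0) (b : ℝ) : Prop :=
  ∀ π : G.BoxStrategy, ENNReal.ofReal b ≤ expectedReward r σ π G.init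

/-- A memoryless (possibly randomised) multi-strategy: in every state of player diamond, a
distribution over the non-empty sets of enabled actions. -/
structure MultiStrategy (G : StochasticGame D B A) where
  choose : D → PMF (Finset A)
  nonempty : ∀ s, ∀ C ∈ (choose s).support, C.Nonempty
  subset_enabled : ∀ s, ∀ C ∈ (choose s).support, C ⊆ G.enabled (Sum.inl s)

/-- `σ` complies with `θ`: for every state `s` and every non-empty `C ⊆ A(s)` there is a
distribution `d s C` on `C` with `σ(s)(a) = ∑_{C ∋ a} θ(s)(C) · d s C a` for all `a ∈ A(s)`. -/
def DiamondStrategy.Complies [DecidableEq A] {G : StochasticGame D B A} (σ : G.DiamondStrategy)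
    (θ : G.MultiStrategy) : Prop :=
  ∃ d : D → Finset A → PMF A,
    (∀ s C, C.Nonempty → C ⊆ G.enabled (Sum.inl s) → (d s C).support ⊆ C) ∧
    ∀ s, ∀ a ∈ G.enabled (Sum.inl s),
      σ.choose s a =
        ∑ C ∈ (G.enabled (Sum.inl s)).powerset with a ∈ C, θ.choose s C * d s C a

/-- `θ` is sound: every strategy that complies with `θ` is sound. -/
def MultiStrategy.Sound [DecidableEq A] {G : StochasticGame D B A} (θ : G.MultiStrategy)
    (r : D ⊕ B → A → ℚ≥0) (b : ℝ) : Prop :=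
  ∀ σ : G.DiamondStrategy, σ.Complies θ → σ.Sound r b

/-- The local penalty of `θ` at `s`: the expected sum of the penalties of the enabled actions
that are disallowed by `θ` in `s`. -/
noncomputable def MultiStrategy.localPenalty [DecidableEq A] {G : StochasticGame D B A}
    (θ : G.MultiStrategy) (ψ : D → A → ℚ≥0) (s : D) : ℝ :=
  ∑ C ∈ (G.enabled (Sum.inl s)).powerset, ∑ a ∈ G.enabled (Sum.inl s) \ C,
    (θ.choose s C).toReal * (ψ s a : ℝ)

/-- The static penalty of `θ`: the sum of the local penalties over the states of diamond. -/
noncomputable def MultiStrategy.staticPenalty [DecidableEq A] {G : StochasticGame D B A}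
    (θ : G.MultiStrategy) (ψ : D → A → ℚ≥0) : ℝ :=
  ∑ s, θ.localPenalty ψ s

end StochasticGame

/-! Resolve the freedom left by `θ` against the controller: the operator `bellman θ` averages, over
the set `C` drawn from `θ(s)`, the least action value in `C`, and takes minima at environment
states. At one state with fixed action values, `θ(s)` is a mean of points (penalty, minimum value).
Some two support points, mixed with weights depending only on the penalties, have no larger penalty
and no smaller value (`exists_mixWeight_le`). Enlarging each set to the upper level set of the
action values at its minimum lowers the penalty, keeps the minimum, and makes the sets nested
(`exists_candidate_ge`). To pass to total reward, discount by `c < 1`. Undiscounted subsolutions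
need not lie below the expected reward (a positive constant on a reward-free loop), but finite
discounted ones do (`le_expectedReward`). The discounted values of `θ` increase, as `c` tends to 1,
to a fixed point of `bellman θ`, which soundness forces to be at least `b` at the initial state
(`ofReal_le_iSup_discountedValue`). The improved distributions depend on `c` but come from a finite
set (`finite_candidates`), so one choice serves infinitely many discounts approaching 1, and that
choice is sound. -/

namespace PMF

/-! ### Expectations under probability mass functions -/

variable {α β : Type*}

/-- The expectation of an extended nonnegative function under a probability mass function. -/
noncomputable def expect (p : PMF α) (f : α → ℝ≥0∞) : ℝ≥0∞ := ∑' a, p a * f a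

lemma expect_mono (p : PMF α) {f g : α → ℝ≥0∞} (h : ∀ a ∈ p.support, f a ≤ g a) :
    p.expect f ≤ p.expect g := by
  refine ENNReal.tsum_le_tsum fun a => ?_
  by_cases ha : a ∈ p.support
  · gcongr
    exact h a ha
  · simp [(p.apply_eq_zero_iff a).2 ha]

lemma expect_congr (p : PMF α) {f g : α → ℝ≥0∞} (h : ∀ a ∈ p.support, f a = g a) :
    p.expect f = p.expect g :=
  le_antisymm (p.expect_mono fun a ha => (h a ha).le) (p.expect_mono fun a ha => (h a ha).ge)

lemma expect_const (p : PMF α) (c : ℝ≥0∞) : p.expect (fun _ => c) = c := by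
  simp [expect, ENNReal.tsum_mul_right]

lemma expect_add (p : PMF α) (f g : α → ℝ≥0∞) :
    p.expect (fun a => f a + g a) = p.expect f + p.expect g := by
  simp [expect, mul_add, ENNReal.tsum_add]

lemma expect_tsum {ι : Type*} (p : PMF α) (f : ι → α → ℝ≥0∞) :
    p.expect (fun a => ∑' i, f i a) = ∑' i, p.expect (f i) := by
  simp only [expect, ← ENNReal.tsum_mul_left]
  exact ENNReal.tsum_comm

lemma expect_sum {ι : Type*} (p : PMF α) (s : Finset ι) (f : ι → α → ℝ≥0∞) :
    p.expect (fun a => ∑ i ∈ s, f i a) = ∑ i ∈ s, p.expect (f i) := by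
  simp only [expect, Finset.mul_sum]
  exact Summable.tsum_finsetSum fun i _ => ENNReal.summable

lemma expect_pure (a : α) (f : α → ℝ≥0∞) : (pure a).expect f = f a := by
  rw [expect, tsum_eq_single a]
  · simp
  · intro b hb
    simp [pure_apply, hb]

lemma expect_bind (p : PMF α) (q : α → PMF β) (f : β → ℝ≥0∞) :
    (p.bind q).expect f = p.expect fun a => (q a).expect f := by
  simp only [expect, bind_apply, ← ENNReal.tsum_mul_left, ← ENNReal.tsum_mul_right]
  rw [ENNReal.tsum_comm]
  simp only [mul_assoc]

lemma expect_map (p : PMF α) (g : α → β) (f : β → ℝ≥0∞) :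
    (p.map g).expect f = p.expect (f ∘ g) := by
  simp only [← bind_pure_comp, expect_bind, Function.comp_def, expect_pure]

lemma lintegral_toMeasure [MeasurableSpace α] [Countable α] [MeasurableSingletonClass α]
    (p : PMF α) (f : α → ℝ≥0∞) : ∫⁻ a, f a ∂p.toMeasure = p.expect f := by
  rw [lintegral_countable']
  refine tsum_congr fun a => ?_
  rw [p.toMeasure_apply_singleton a (MeasurableSet.singleton a), mul_comm]

lemma expect_ne_top [Finite α] (p : PMF α) {f : α → ℝ≥0∞} (h : ∀ a ∈ p.support, f a ≠ ∞) :
    p.expect f ≠ ∞ := by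
  have := Fintype.ofFinite α
  rw [expect, tsum_fintype]
  refine ENNReal.sum_ne_top.2 fun a _ => ?_
  by_cases ha : a ∈ p.support
  · exact ENNReal.mul_ne_top (p.apply_ne_top a) (h a ha)
  · simp [(p.apply_eq_zero_iff a).2 ha]

lemma continuous_expect [Finite α] {X : Type*} [TopologicalSpace X] (p : PMF α)
    {f : X → α → ℝ≥0∞} (h : ∀ a, Continuous fun x => f x a) :
    Continuous fun x => p.expect (f x) := by
  have := Fintype.ofFinite α
  simp only [expect, tsum_fintype]
  exact continuous_finsetSum _ fun a _ => (ENNReal.continuous_const_mul (p.apply_ne_top a)).comp (h a)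

end PMF

/-! ### Policy evaluation on the path space -/

namespace StochasticGame

variable {D B A : Type*} [Fintype D] [Fintype B] [Fintype A] {G : StochasticGame D B A}

/-- The reward of the action `a` in the state `s` plus the expectation of `y` at the successor. -/
noncomputable def actionValue (G : StochasticGame D B A) (r : D ⊕ B → A → ℚ≥0)
    (y : D ⊕ B → ℝ≥0∞) (s : D ⊕ B) (a : A) : ℝ≥0∞ :=
  ((r s a : ℝ≥0) : ℝ≥0∞) + (G.next s a).expect y

lemma actionValue_eq (r : D ⊕ B → A → ℚ≥0) (y : D ⊕ B → ℝ≥0∞) (s : D ⊕ B) :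
    G.actionValue r y s = fun a => ((r s a : ℝ≥0) : ℝ≥0∞) + (G.next s a).expect y := rfl

/-- One step of policy evaluation. -/
noncomputable def policyStep (r : D ⊕ B → A → ℚ≥0) (σ : G.DiamondStrategy) (π : G.BoxStrategy)
    (y : D ⊕ B → ℝ≥0∞) (s : D ⊕ B) : ℝ≥0∞ :=
  (actionDist σ π s).expect (G.actionValue r y s)

lemma actionValue_mono (r : D ⊕ B → A → ℚ≥0) {y z : D ⊕ B → ℝ≥0∞} (h : y ≤ z) (s : D ⊕ B)
    (a : A) : G.actionValue r y s a ≤ G.actionValue r z s a :=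
  add_le_add_right (PMF.expect_mono _ fun t _ => h t) _

lemma policyStep_mono (r : D ⊕ B → A → ℚ≥0) (σ : G.DiamondStrategy) (π : G.BoxStrategy)
    {y z : D ⊕ B → ℝ≥0∞} (h : y ≤ z) : policyStep r σ π y ≤ policyStep r σ π z :=
  fun s => PMF.expect_mono _ fun a _ => actionValue_mono r h s a

lemma policyStep_add_const (r : D ⊕ B → A → ℚ≥0) (σ : G.DiamondStrategy) (π : G.BoxStrategy)
    (y : D ⊕ B → ℝ≥0∞) (c : ℝ≥0∞) (s : D ⊕ B) :
    policyStep r σ π (fun t => y t + c) s = policyStep r σ π y s + c := by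
  simp only [policyStep, actionValue_eq, PMF.expect_add, PMF.expect_const, add_assoc]

/-- The expected reward of the `n`-th step. -/
noncomputable def rewardAt (r : D ⊕ B → A → ℚ≥0) (σ : G.DiamondStrategy) (π : G.BoxStrategy)
    (n : ℕ) (s : D ⊕ B) : ℝ≥0∞ :=
  ∫⁻ ω, ((r (ω n).1 (ω n).2 : ℝ≥0) : ℝ≥0∞) ∂(pathMeasure σ π s)

instance (σ : G.DiamondStrategy) (π : G.BoxStrategy) (s : D ⊕ B) :
    IsProbabilityMeasure (pathMeasure σ π s) :=
  inferInstanceAs (IsProbabilityMeasure (Kernel.trajMeasure _ _))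

lemma lintegral_pathMeasure_zero (σ : G.DiamondStrategy) (π : G.BoxStrategy) (s : D ⊕ B)
    (f : Step (D ⊕ B) A → ℝ≥0∞) :
    ∫⁻ ω, f (ω 0) ∂(pathMeasure σ π s) = (stepFrom σ π s).expect f := by
  have h : (pathMeasure σ π s).map (fun ω => ω 0) = (stepFrom σ π s).toMeasure := by
    have e : (fun ω : ℕ → Step (D ⊕ B) A => ω 0) =
        (fun x : (i : Finset.Iic 0) → Step (D ⊕ B) A => x ⟨0, by simp⟩) ∘
          Preorder.frestrictLe (π := fun _ => Step (D ⊕ B) A) 0 := rfl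
    rw [e, ← Measure.map_map (by fun_prop) (by fun_prop), pathMeasure, Kernel.trajMeasure,
      Measure.map_comp _ _ (by fun_prop), Kernel.traj_map_frestrictLe, Kernel.partialTraj_self,
      Measure.id_comp, Measure.map_map (by fun_prop) (by fun_prop)]
    exact Measure.map_id
  rw [← PMF.lintegral_toMeasure, ← h, lintegral_map (.of_discrete) (by fun_prop)]

/-- The Markov property: disintegrating the path measure at time `n` leaves a kernel that reads only
the last step of the history. -/
lemma lintegral_pathMeasure_succ (σ : G.DiamondStrategy) (π : G.BoxStrategy) (s : D ⊕ B)
    (f : Step (D ⊕ B) A → ℝ≥0∞) (n : ℕ) :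
    ∫⁻ ω, f (ω (n + 1)) ∂(pathMeasure σ π s) =
      ∫⁻ ω, (stepAfter σ π (ω n)).expect f ∂(pathMeasure σ π s) := by
  have hf : Measurable f := .of_discrete
  have h := Kernel.map_frestrictLe_trajMeasure_compProd_eq_map_trajMeasure
    (X := fun _ => Step (D ⊕ B) A) (μ₀ := (stepFrom σ π s).toMeasure) (κ := stepKernel σ π) (a := n)
  have h' := congrArg (fun μ => ∫⁻ z, f z.2 ∂μ) h
  beta_reduce at h'
  rw [Measure.lintegral_compProd (by fun_prop), lintegral_map (by fun_prop) (by fun_prop),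
    lintegral_map] at h'
  rotate_left
  · fun_prop
  · fun_prop
  refine h'.symm.trans (lintegral_congr fun ω => ?_)
  exact PMF.lintegral_toMeasure _ _

lemma stepFrom_expect (σ : G.DiamondStrategy) (π : G.BoxStrategy) (s : D ⊕ B)
    (f : Step (D ⊕ B) A → ℝ≥0∞) :
    (stepFrom σ π s).expect f = (actionDist σ π s).expect fun a => f (s, a) :=
  PMF.expect_map _ _ _

/-- Turns the recursion on the last step, which the trajectory measure supplies, into one on the
first step, which policy evaluation needs. The last transition is absorbed into the test function,
so the induction must vary `f`. -/
lemma lintegral_pathMeasure_shift (σ : G.DiamondStrategy) (π : G.BoxStrategy)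
    (f : Step (D ⊕ B) A → ℝ≥0∞) (n : ℕ) (s : D ⊕ B) :
    ∫⁻ ω, f (ω (n + 1)) ∂(pathMeasure σ π s) =
      (actionDist σ π s).expect fun a =>
        (G.next s a).expect fun t => ∫⁻ ω, f (ω n) ∂(pathMeasure σ π t) := by
  induction n generalizing f with
  | zero =>
    rw [lintegral_pathMeasure_succ, lintegral_pathMeasure_zero σ π s fun x => (stepAfter σ π x).expect f,
      stepFrom_expect]
    simp only [stepAfter, PMF.expect_bind, lintegral_pathMeasure_zero]
  | succ n ih =>
    rw [lintegral_pathMeasure_succ, ih fun x => (stepAfter σ π x).expect f]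
    simp only [← lintegral_pathMeasure_succ]

lemma expectedReward_eq_tsum (r : D ⊕ B → A → ℚ≥0) (σ : G.DiamondStrategy) (π : G.BoxStrategy)
    (s : D ⊕ B) : expectedReward r σ π s = ∑' n, rewardAt r σ π n s := by
  have hf : Measurable fun x : Step (D ⊕ B) A => ((r x.1 x.2 : ℝ≥0) : ℝ≥0∞) := .of_discrete
  exact lintegral_tsum fun n => (hf.comp (measurable_pi_apply n)).aemeasurable

lemma rewardAt_zero (r : D ⊕ B → A → ℚ≥0) (σ : G.DiamondStrategy) (π : G.BoxStrategy)
    (s : D ⊕ B) :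
    rewardAt r σ π 0 s = (actionDist σ π s).expect fun a => ((r s a : ℝ≥0) : ℝ≥0∞) := by
  rw [rewardAt, lintegral_pathMeasure_zero σ π s fun x => ((r x.1 x.2 : ℝ≥0) : ℝ≥0∞),
    stepFrom_expect]

lemma rewardAt_succ (r : D ⊕ B → A → ℚ≥0) (σ : G.DiamondStrategy) (π : G.BoxStrategy) (n : ℕ)
    (s : D ⊕ B) :
    rewardAt r σ π (n + 1) s =
      (actionDist σ π s).expect fun a => (G.next s a).expect (rewardAt r σ π n) :=
  lintegral_pathMeasure_shift σ π (fun x => ((r x.1 x.2 : ℝ≥0) : ℝ≥0∞)) n s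

lemma sum_rewardAt_succ (r : D ⊕ B → A → ℚ≥0) (σ : G.DiamondStrategy) (π : G.BoxStrategy)
    (n : ℕ) (s : D ⊕ B) :
    ∑ k ∈ Finset.range (n + 1), rewardAt r σ π k s =
      policyStep r σ π (fun t => ∑ k ∈ Finset.range n, rewardAt r σ π k t) s := by
  simp only [Finset.sum_range_succ', rewardAt_succ, rewardAt_zero, policyStep, actionValue_eq,
    PMF.expect_add, PMF.expect_sum]
  rw [add_comm]

/-- The expected total reward is a fixed point of policy evaluation. -/
lemma policyStep_expectedReward (r : D ⊕ B → A → ℚ≥0) (σ : G.DiamondStrategy)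
    (π : G.BoxStrategy) : policyStep r σ π (expectedReward r σ π) = expectedReward r σ π := by
  funext s
  have h : expectedReward r σ π = fun t => ∑' n, rewardAt r σ π n t :=
    funext (expectedReward_eq_tsum r σ π)
  rw [h]
  simp only [tsum_eq_zero_add' (M := ℝ≥0∞) (f := fun n => rewardAt r σ π n s) ENNReal.summable,
    rewardAt_succ, rewardAt_zero, policyStep, actionValue_eq, PMF.expect_add, PMF.expect_tsum]

/-- The expected total reward lies below every supersolution of the evaluation equation. -/
lemma expectedReward_le {r : D ⊕ B → A → ℚ≥0} {σ : G.DiamondStrategy} {π : G.BoxStrategy}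
    {y : D ⊕ B → ℝ≥0∞} (hy : policyStep r σ π y ≤ y) : expectedReward r σ π ≤ y := by
  have h : ∀ n s, ∑ k ∈ Finset.range n, rewardAt r σ π k s ≤ y s := by
    intro n
    induction n with
    | zero => simp
    | succ n ih =>
      intro s
      rw [sum_rewardAt_succ]
      exact (policyStep_mono r σ π ih s).trans (hy s)
  intro s
  rw [expectedReward_eq_tsum]
  exact ENNReal.summable.tsum_le_of_sum_range_le fun n => h n s

/-- A bounded subsolution of the discounted evaluation equation lies below the undiscounted
expected total reward. -/
lemma le_expectedReward {r : D ⊕ B → A → ℚ≥0} {σ : G.DiamondStrategy} {π : G.BoxStrategy}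
    {y : D ⊕ B → ℝ≥0∞} {c : ℝ≥0∞} (hc : c < 1) (hfin : ∀ s, y s ≠ ∞)
    (hy : ∀ s, y s ≤ c * policyStep r σ π y s) : y ≤ expectedReward r σ π := by
  set M : ℝ≥0∞ := ∑ s, y s with hM
  have hMtop : M ≠ ∞ := ENNReal.sum_ne_top.2 fun s _ => hfin s
  -- Unrolling `n` times leaves an error of at most `c ^ n * M`, since a constant passes through
  -- `policyStep` unchanged. It vanishes in the limit because `c < 1` and `M` is finite.
  have h : ∀ n s, y s ≤ ∑ k ∈ Finset.range n, rewardAt r σ π k s + c ^ n * M := by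
    intro n
    induction n with
    | zero =>
      intro s
      rw [Finset.sum_range_zero, zero_add, pow_zero, one_mul]
      exact Finset.single_le_sum (f := y) (fun _ _ => zero_le) (Finset.mem_univ s)
    | succ n ih =>
      intro s
      calc y s ≤ c * policyStep r σ π y s := hy s
        _ ≤ c * (policyStep r σ π (fun t => ∑ k ∈ Finset.range n, rewardAt r σ π k t) s +
              c ^ n * M) := by
            rw [← policyStep_add_const]
            gcongr
            exact policyStep_mono r σ π ih s
        _ ≤ _ := by
            rw [sum_rewardAt_succ, mul_add, pow_succ', mul_assoc]
            gcongr
            exact mul_le_of_le_one_left (zero_le) hc.le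
  intro s
  have hlim : Filter.Tendsto (fun n : ℕ => expectedReward r σ π s + c ^ n * M) Filter.atTop
      (nhds (expectedReward r σ π s + 0 * M)) :=
    (ENNReal.Tendsto.mul_const (ENNReal.tendsto_pow_atTop_nhds_zero_of_lt_one hc)
      (Or.inr hMtop)).const_add _
  rw [zero_mul, add_zero] at hlim
  refine ge_of_tendsto' hlim fun n => (h n s).trans ?_
  gcongr
  rw [expectedReward_eq_tsum]
  exact ENNReal.sum_le_tsum _

end StochasticGame

/-! ### Value iteration for a multi-strategy and its discounted values -/

namespace StochasticGame

variable {D B A : Type*} [Fintype D] [Fintype B] [Fintype A] {G : StochasticGame D B A}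

/-- One step of value iteration when player box resolves all choices left open by `θ`. -/
noncomputable def bellman (θ : G.MultiStrategy) (r : D ⊕ B → A → ℚ≥0) (y : D ⊕ B → ℝ≥0∞) :
    D ⊕ B → ℝ≥0∞ :=
  Sum.elim (fun s => (θ.choose s).expect fun C => C.inf (G.actionValue r y (Sum.inl s)))
    (fun s => (G.enabled (Sum.inr s)).inf (G.actionValue r y (Sum.inr s)))

lemma bellman_mono (θ : G.MultiStrategy) (r : D ⊕ B → A → ℚ≥0) : Monotone (bellman θ r) := by
  rintro y z h (s | s)
  · exact PMF.expect_mono _ fun C _ => Finset.inf_mono_fun fun a _ => actionValue_mono r h _ a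
  · exact Finset.inf_mono_fun fun a _ => actionValue_mono r h _ a

lemma continuous_actionValue (r : D ⊕ B → A → ℚ≥0) (s : D ⊕ B) (a : A) :
    Continuous fun y => G.actionValue r y s a :=
  (PMF.continuous_expect _ fun t => continuous_apply t).const_add _

lemma continuous_bellman (θ : G.MultiStrategy) (r : D ⊕ B → A → ℚ≥0) :
    Continuous (bellman θ r) := by
  refine continuous_pi ?_
  rintro (s | s)
  · exact PMF.continuous_expect _ fun C =>
      Continuous.finset_inf_apply fun a _ => continuous_actionValue r _ a
  · exact Continuous.finset_inf_apply fun a _ => continuous_actionValue r _ a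

/-- An average over `C`, or over the enabled actions of the environment, is at least the minimum
there. -/
lemma bellman_le_policyStep [DecidableEq A] {θ : G.MultiStrategy} {σ : G.DiamondStrategy}
    (hσ : σ.Complies θ) (π : G.BoxStrategy) (r : D ⊕ B → A → ℚ≥0) (y : D ⊕ B → ℝ≥0∞) :
    bellman θ r y ≤ policyStep r σ π y := by
  rintro (s | s)
  · obtain ⟨d, hd, hσ⟩ := hσ
    set v := G.actionValue r y (Sum.inl s) with hv
    set E := G.enabled (Sum.inl s) with hE
    have h1 : policyStep r σ π y (Sum.inl s) = ∑ a ∈ E, σ.choose s a * v a := by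
      rw [policyStep, PMF.expect, tsum_fintype]
      refine (Finset.sum_subset (Finset.subset_univ _) fun a _ ha => ?_).symm
      have : σ.choose s a = 0 := by
        rw [PMF.apply_eq_zero_iff]
        exact fun h => ha (σ.mem_enabled s a h)
      simp [actionDist, this]
    -- Exchanging the sums groups the action weights of `σ` by the drawn set `C`.
    have h2 : policyStep r σ π y (Sum.inl s) =
        ∑ C ∈ E.powerset, θ.choose s C * ∑ a ∈ C, d s C a * v a := by
      rw [h1, Finset.sum_congr rfl fun a ha => by rw [hσ s a ha, Finset.sum_mul]]
      simp only [Finset.sum_filter, Finset.mul_sum]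
      rw [Finset.sum_comm]
      refine Finset.sum_congr rfl fun C hC => ?_
      rw [← Finset.sum_filter, Finset.filter_mem_eq_inter,
        Finset.inter_eq_right.2 (Finset.mem_powerset.1 hC)]
      simp only [mul_assoc]
    rw [h2]
    change (θ.choose s).expect _ ≤ _
    rw [PMF.expect, tsum_fintype, ← Finset.sum_subset (Finset.subset_univ E.powerset)]
    · refine Finset.sum_le_sum fun C hC => ?_
      by_cases h0 : θ.choose s C = 0
      · simp [h0]
      have hne := θ.nonempty s C ((PMF.mem_support_iff _ _).2 h0)
      gcongr
      have hsum : ∑ a ∈ C, d s C a = 1 := by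
        have hsupp := hd s C hne (Finset.mem_powerset.1 hC)
        rw [← (d s C).tsum_coe, tsum_fintype]
        refine Finset.sum_subset (Finset.subset_univ _) fun a _ ha => ?_
        rw [PMF.apply_eq_zero_iff]
        exact fun h => ha (hsupp h)
      calc C.inf v = ∑ a ∈ C, d s C a * C.inf v := by rw [← Finset.sum_mul, hsum, one_mul]
        _ ≤ _ := Finset.sum_le_sum fun a ha => by
          gcongr
          exact Finset.inf_le ha
    · intro C _ hC
      have : θ.choose s C = 0 := by
        rw [PMF.apply_eq_zero_iff]
        exact fun h => hC (Finset.mem_powerset.2 (θ.subset_enabled s C h))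
      simp [this]
  · change _ ≤ (π.choose s).expect _
    rw [← (π.choose s).expect_const (bellman θ r y (Sum.inr s))]
    exact PMF.expect_mono _ fun a ha => Finset.inf_le (π.mem_enabled s a ha)

/-- Minima over finite nonempty sets are attained, so both players can play a worst action for the
controller with respect to `y`. The pair depends on `y`. -/
lemma exists_policyStep_eq_bellman [DecidableEq A]
    (hB : ∀ s : B, (G.enabled (Sum.inr s)).Nonempty) (θ : G.MultiStrategy)
    (r : D ⊕ B → A → ℚ≥0) (y : D ⊕ B → ℝ≥0∞) :
    ∃ (σ : G.DiamondStrategy) (π : G.BoxStrategy),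
      σ.Complies θ ∧ policyStep r σ π y = bellman θ r y := by
  have hA : ∀ s : D, Nonempty A := fun s =>
    let ⟨C, hC⟩ := (θ.choose s).support_nonempty
    ⟨(θ.nonempty s C hC).choose⟩
  have hmin : ∀ (s : D) (C : Finset A), ∃ a, C.Nonempty →
      a ∈ C ∧ G.actionValue r y (Sum.inl s) a = C.inf (G.actionValue r y (Sum.inl s)) := by
    intro s C
    by_cases h : C.Nonempty
    · obtain ⟨a, ha, he⟩ := C.exists_mem_eq_inf h (G.actionValue r y (Sum.inl s))
      exact ⟨a, fun _ => ⟨ha, he.symm⟩⟩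
    -- A default for the empty set, to which `θ` gives no mass.
    · exact ⟨(hA s).some, fun h' => (h h').elim⟩
  choose m hm using hmin
  have hbox : ∀ s : B, ∃ a ∈ G.enabled (Sum.inr s),
      (G.enabled (Sum.inr s)).inf (G.actionValue r y (Sum.inr s)) =
        G.actionValue r y (Sum.inr s) a := fun s => Finset.exists_mem_eq_inf _ (hB s) _
  choose p hp hpe using hbox
  refine ⟨⟨fun s => (θ.choose s).bind fun C => PMF.pure (m s C), ?_⟩, ⟨fun s => PMF.pure (p s), ?_⟩,
    ⟨fun s C => PMF.pure (m s C), ?_, ?_⟩, ?_⟩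
  · intro s a ha
    simp only [PMF.mem_support_bind_iff, PMF.mem_support_pure_iff] at ha
    obtain ⟨C, hC, rfl⟩ := ha
    exact θ.subset_enabled s C hC (hm s C (θ.nonempty s C hC)).1
  · intro s a ha
    rw [PMF.mem_support_pure_iff] at ha
    exact ha ▸ hp s
  · intro s C hC _ a ha
    rw [PMF.mem_support_pure_iff] at ha
    exact ha ▸ (hm s C hC).1
  · intro s a _
    rw [PMF.bind_apply, tsum_fintype]
    refine (Finset.sum_subset (Finset.subset_univ _) fun C _ hC => ?_).symm
    by_cases h : C ∈ (θ.choose s).support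
    · have hne := θ.nonempty s C h
      rw [Finset.mem_filter, Finset.mem_powerset, not_and] at hC
      have haC := hC (θ.subset_enabled s C h)
      have : a ≠ m s C := fun e => haC (e ▸ (hm s C hne).1)
      simp [PMF.pure_apply, this]
    · rw [(PMF.apply_eq_zero_iff _ _).2 h, zero_mul]
  · funext s
    rcases s with s | s
    · change PMF.expect (PMF.bind _ _) _ = PMF.expect _ _
      rw [PMF.expect_bind]
      refine PMF.expect_congr _ fun C hC => ?_
      rw [PMF.expect_pure, (hm s C (θ.nonempty s C hC)).2]
    · exact (PMF.expect_pure _ _).trans (hpe s).symm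

lemma actionValue_ne_top (r : D ⊕ B → A → ℚ≥0) {y : D ⊕ B → ℝ≥0∞} (hy : ∀ s, y s ≠ ∞)
    (s : D ⊕ B) (a : A) : G.actionValue r y s a ≠ ∞ :=
  ENNReal.add_ne_top.2 ⟨ENNReal.coe_ne_top, PMF.expect_ne_top _ fun t _ => hy t⟩

/-- The least fixed point of value iteration discounted by `c`. -/
noncomputable def discountedValue (θ : G.MultiStrategy) (r : D ⊕ B → A → ℚ≥0) (c : ℝ≥0∞) :
    D ⊕ B → ℝ≥0∞ :=
  OrderHom.lfp ⟨fun y s => c * bellman θ r y s,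
    fun _ _ h s => mul_le_mul_right (bellman_mono θ r h s) c⟩

lemma discountedValue_eq (θ : G.MultiStrategy) (r : D ⊕ B → A → ℚ≥0) (c : ℝ≥0∞) (s : D ⊕ B) :
    c * bellman θ r (discountedValue θ r c) s = discountedValue θ r c s :=
  congrFun (OrderHom.map_lfp ⟨fun y s => c * bellman θ r y s,
    fun _ _ h s => mul_le_mul_right (bellman_mono θ r h s) c⟩) s

lemma discountedValue_le {θ : G.MultiStrategy} {r : D ⊕ B → A → ℚ≥0} {c : ℝ≥0∞}
    {y : D ⊕ B → ℝ≥0∞} (h : ∀ s, c * bellman θ r y s ≤ y s) : discountedValue θ r c ≤ y :=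
  OrderHom.lfp_le _ h

lemma discountedValue_mono (θ : G.MultiStrategy) (r : D ⊕ B → A → ℚ≥0) :
    Monotone (discountedValue θ r) := fun _ c' h =>
  discountedValue_le fun s => (discountedValue_eq θ r c' s).le.trans' (mul_le_mul_left h _)

/-- The expected reward of any pair whose controller strategy complies with `θ` is a supersolution
of the discounted equation, so it dominates the least fixed point. The greedy pair for `0` merely
supplies such a pair. -/
lemma discountedValue_ne_top [DecidableEq A] (hB : ∀ s : B, (G.enabled (Sum.inr s)).Nonempty)
    {r : D ⊕ B → A → ℚ≥0} (hr : G.FiniteMaxReward r) (θ : G.MultiStrategy) {c : ℝ≥0∞}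
    (hc : c ≤ 1) (s : D ⊕ B) : discountedValue θ r c s ≠ ∞ := by
  obtain ⟨σ, π, hσ, -⟩ := exists_policyStep_eq_bellman hB θ r 0
  have h : discountedValue θ r c ≤ expectedReward r σ π := discountedValue_le fun t =>
    (mul_le_of_le_one_left zero_le hc).trans <|
      (bellman_le_policyStep hσ π r _ t).trans (congrFun (policyStep_expectedReward r σ π) t).le
  exact ((h s).trans (le_iSup₂ (f := fun σ π => expectedReward r σ π s) σ π)).trans_lt (hr s) |>.ne

/-- The discounted values approximate the bound guaranteed by a sound multi-strategy. -/
lemma ofReal_le_iSup_discountedValue [DecidableEq A]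
    (hB : ∀ s : B, (G.enabled (Sum.inr s)).Nonempty)
    {r : D ⊕ B → A → ℚ≥0} {b : ℝ} {θ : G.MultiStrategy} (hθ : θ.Sound r b) {c : ℕ → ℝ≥0∞}
    (hc : Monotone c) (hlim : Filter.Tendsto c Filter.atTop (nhds 1)) :
    ENNReal.ofReal b ≤ ⨆ n, discountedValue θ r (c n) G.init := by
  set y : D ⊕ B → ℝ≥0∞ := fun s => ⨆ n, discountedValue θ r (c n) s with hy
  have hty : Filter.Tendsto (fun n => discountedValue θ r (c n)) Filter.atTop (nhds y) :=
    tendsto_pi_nhds.2 fun s =>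
      tendsto_atTop_iSup fun m n h => discountedValue_mono θ r (hc h) s
  -- Continuity of `bellman θ r` lets the discounted fixed-point equations pass to the limit `c →
  -- 1`.
  have hfix : bellman θ r y = y := by
    funext s
    have h1 := tendsto_pi_nhds.1 (((continuous_bellman θ r).tendsto y).comp hty) s
    have h2 := ENNReal.Tendsto.mul hlim (Or.inl one_ne_zero) h1 (Or.inr ENNReal.one_ne_top)
    simp only [Function.comp_apply, discountedValue_eq, one_mul] at h2
    exact tendsto_nhds_unique h2 (tendsto_pi_nhds.1 hty s)
  -- For the greedy pair `y` is a fixed point of policy evaluation, so it dominates their expected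
  -- reward, which soundness bounds below.
  obtain ⟨σ, π, hσ, he⟩ := exists_policyStep_eq_bellman hB θ r y
  exact (hθ σ hσ π).trans (expectedReward_le (he.trans hfix).le G.init)

end StochasticGame

/-! ### Reduction of a distribution to two points -/

namespace StochasticGame

/-- The weight of the first of two points with penalties `p` and `q` in the mixture whose penalty
is `P`, if `p ≤ P < q`; otherwise `1`. -/
noncomputable def mixWeight (P p q : ℝ) : ℝ := if P < q then (q - P) / (q - p) else 1

lemma mixWeight_nonneg {P p : ℝ} (h : p ≤ P) (q : ℝ) : 0 ≤ mixWeight P p q := by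
  unfold mixWeight
  split_ifs with hq
  · exact div_nonneg (by linarith) (by linarith)
  · exact zero_le_one

lemma mixWeight_le_one {P p : ℝ} (h : p ≤ P) (q : ℝ) : mixWeight P p q ≤ 1 := by
  unfold mixWeight
  split_ifs with hq
  · rw [div_le_one (by linarith)]
    linarith
  · exact le_rfl

lemma mixWeight_penalty_le {P p : ℝ} (h : p ≤ P) (q : ℝ) :
    mixWeight P p q * p + (1 - mixWeight P p q) * q ≤ P := by
  unfold mixWeight
  split_ifs with hq
  · have : q - p ≠ 0 := by linarith
    apply le_of_eq
    field_simp
    ring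
  · linarith

/-- A distribution with mean penalty `P` is dominated in value by a mixture of at most two points
of its support with mean penalty at most `P`; the weights of the mixture depend only on the
penalties. -/
lemma exists_mixWeight_le {ι : Type*} [Fintype ι] {θ p w : ι → ℝ} {P : ℝ} (h0 : ∀ i, 0 ≤ θ i)
    (h1 : ∑ i, θ i = 1) (hP : ∑ i, θ i * p i = P) :
    ∃ i j, 0 < θ i ∧ 0 < θ j ∧ p i ≤ P ∧
      ∑ k, θ k * w k ≤ mixWeight P (p i) (p j) * w i + (1 - mixWeight P (p i) (p j)) * w j := by
  classical
  set M := ∑ k, θ k * w k with hM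
  set I := Finset.univ.filter fun i => 0 < θ i ∧ p i ≤ P with hI
  set J := Finset.univ.filter fun i => 0 < θ i ∧ ¬ p i ≤ P with hJ
  have split : ∀ f : ι → ℝ, ∑ i, θ i * f i = ∑ i ∈ I, θ i * f i + ∑ i ∈ J, θ i * f i := by
    intro f
    rw [hI, hJ, ← Finset.filter_filter, ← Finset.filter_filter,
      Finset.sum_filter_add_sum_filter_not]
    refine (Finset.sum_subset (Finset.subset_univ _) fun i _ hi => ?_).symm
    have : θ i = 0 := by
      by_contra h
      exact hi (by simpa using lt_of_le_of_ne (h0 i) (Ne.symm h))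
    rw [this, zero_mul]
  have hw : ∑ i, θ i * (w i - M) = 0 := by
    simp only [mul_sub, Finset.sum_sub_distrib, ← Finset.sum_mul, h1, ← hM]
    ring
  have hp : ∑ i, θ i * (p i - P) = 0 := by
    simp only [mul_sub, Finset.sum_sub_distrib, ← Finset.sum_mul, h1, hP]
    ring
  rw [split] at hw hp
  rcases J.eq_empty_or_nonempty with hJe | hJn
  -- No support point exceeds the mean penalty, so a single point of at least average value
  -- suffices, taken twice.
  · rw [hJe, Finset.sum_empty, add_zero] at hw
    have hIn : I.Nonempty := by
      rw [Finset.nonempty_iff_ne_empty]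
      intro hIe
      have := split fun _ => 1
      simp [hIe, hJe, h1] at this
    obtain ⟨i, hi, hle⟩ := Finset.exists_le_of_sum_le (f := fun _ => (0 : ℝ)) hIn
      (by simpa using hw.ge)
    obtain ⟨hθi, hpi⟩ := (Finset.mem_filter.1 hi).2
    have := nonneg_of_mul_nonneg_right hle hθi
    exact ⟨i, i, hθi, hθi, hpi, by nlinarith⟩
  · have hK : 0 < ∑ j ∈ J, θ j * (p j - P) := by
      refine Finset.sum_pos (fun j hj => ?_) hJn
      obtain ⟨hθj, hpj⟩ := (Finset.mem_filter.1 hj).2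
      exact mul_pos hθj (by linarith)
    have hIn : I.Nonempty := by
      rw [Finset.nonempty_iff_ne_empty]
      intro hIe
      rw [hIe, Finset.sum_empty] at hp
      linarith
    -- The bracket is `p j - p i` times the excess over `M` of the mixture of `i` and `j` with
    -- penalty exactly `P`. Weighted by `θ i * θ j`, these terms sum to a 2×2 determinant that
    -- vanishes by `hw` and `hp`, so some pair has nonnegative excess.
    have hzero : ∑ x ∈ I ×ˢ J,
        θ x.1 * θ x.2 * ((p x.2 - P) * (w x.1 - M) + (P - p x.1) * (w x.2 - M)) = 0 := by
      have e : ∑ x ∈ I ×ˢ J,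
          θ x.1 * θ x.2 * ((p x.2 - P) * (w x.1 - M) + (P - p x.1) * (w x.2 - M)) =
          (∑ i ∈ I, θ i * (w i - M)) * (∑ j ∈ J, θ j * (p j - P)) -
            (∑ i ∈ I, θ i * (p i - P)) * (∑ j ∈ J, θ j * (w j - M)) := by
        rw [Finset.sum_mul_sum, Finset.sum_mul_sum, ← Finset.sum_product', ← Finset.sum_product',
          ← Finset.sum_sub_distrib]
        exact Finset.sum_congr rfl fun x _ => by ring
      rw [e]
      linear_combination (∑ j ∈ J, θ j * (p j - P)) * hw - (∑ j ∈ J, θ j * (w j - M)) * hp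
    obtain ⟨⟨i, j⟩, hij, hle⟩ := Finset.exists_le_of_sum_le (f := fun _ => (0 : ℝ))
      (hIn.product hJn) (by simpa using hzero.ge)
    obtain ⟨hi, hj⟩ := Finset.mem_product.1 hij
    obtain ⟨hθi, hpi⟩ := (Finset.mem_filter.1 hi).2
    obtain ⟨hθj, hpj⟩ := (Finset.mem_filter.1 hj).2
    rw [not_le] at hpj
    have hnn := nonneg_of_mul_nonneg_right hle (mul_pos hθi hθj)
    refine ⟨i, j, hθi, hθj, hpi, ?_⟩
    rw [mixWeight, if_pos hpj]
    have hd : 0 < p j - p i := by linarith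
    have e : (p j - P) / (p j - p i) * w i + (1 - (p j - P) / (p j - p i)) * w j =
        ((p j - P) * w i + (P - p i) * w j) / (p j - p i) := by
      field_simp
      ring
    rw [e, le_div_iff₀ hd]
    linarith

/-! ### Nested pairs of action sets -/

/-- The distribution that gives weight `t` (truncated to the unit interval) to `C` and the
remaining weight to `C'`. -/
noncomputable def pairPMF {A : Type*} (t : ℝ) (C C' : Finset A) : PMF (Finset A) :=
  (PMF.ofFintype (fun b : Bool => cond b (min (ENNReal.ofReal t) 1)
    (1 - min (ENNReal.ofReal t) 1)) (by simp)).map fun b => cond b C C'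

lemma support_pairPMF_subset {A : Type*} (t : ℝ) (C C' : Finset A) :
    (pairPMF t C C').support ⊆ {C, C'} := by
  intro E hE
  rw [pairPMF, PMF.mem_support_map_iff] at hE
  obtain ⟨b, -, rfl⟩ := hE
  cases b <;> simp

lemma expect_pairPMF {A : Type*} {t : ℝ} (h0 : 0 ≤ t) (h1 : t ≤ 1) (C C' : Finset A)
    (f : Finset A → ℝ≥0∞) :
    (pairPMF t C C').expect f =
      ENNReal.ofReal t * f C + ENNReal.ofReal (1 - t) * f C' := by
  have ht : min (ENNReal.ofReal t) 1 = ENNReal.ofReal t := min_eq_left (ENNReal.ofReal_le_one.2 h1)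
  have e : ENNReal.ofReal (1 - t) = 1 - ENNReal.ofReal t := by
    rw [ENNReal.ofReal_sub _ h0, ENNReal.ofReal_one]
  rw [pairPMF, PMF.expect_map, PMF.expect, tsum_fintype, Fintype.sum_bool, e]
  simp [ht]

/-- The penalty of disallowing the actions of `E` that are not in `C`. -/
def setPenalty {A : Type*} [DecidableEq A] (ψ : A → ℚ≥0) (E C : Finset A) : ℝ := ∑ a ∈ E \ C, (ψ a : ℝ)

lemma setPenalty_nonneg {A : Type*} [DecidableEq A] (ψ : A → ℚ≥0) (E C : Finset A) :
    0 ≤ setPenalty ψ E C := Finset.sum_nonneg fun _ _ => NNRat.cast_nonneg _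

lemma setPenalty_anti {A : Type*} [DecidableEq A] (ψ : A → ℚ≥0) (E : Finset A) {C C' : Finset A}
    (h : C ⊆ C') : setPenalty ψ E C' ≤ setPenalty ψ E C :=
  Finset.sum_le_sum_of_subset_of_nonneg (Finset.sdiff_subset_sdiff le_rfl h)
    fun _ _ _ => NNRat.cast_nonneg _

lemma sum_toReal_mul_eq_toReal_expect {α : Type*} [Fintype α] (p : PMF α) {f : α → ℝ≥0∞}
    (hf : ∀ a ∈ p.support, f a ≠ ∞) :
    ∑ a, (p a).toReal * (f a).toReal = (p.expect f).toReal := by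
  rw [PMF.expect, tsum_fintype, ENNReal.toReal_sum]
  · simp only [ENNReal.toReal_mul]
  · intro a _
    by_cases ha : a ∈ p.support
    · exact ENNReal.mul_ne_top (p.apply_ne_top a) (hf a ha)
    · simp [(p.apply_eq_zero_iff a).2 ha]

variable {D B A : Type*} [Fintype D] [Fintype B] [Fintype A]

/-- The chain distributions on two sets of enabled actions whose penalty is at most that of `q`. -/
def candidates [DecidableEq A] (ψ : A → ℚ≥0) (E : Finset A) (q : PMF (Finset A)) :
    Set (PMF (Finset A)) :=
  let P := (q.expect fun C => ENNReal.ofReal (setPenalty ψ E C)).toReal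
  {q' | (∃ x : (Finset A × Finset A) × Finset A × Finset A,
      q' = pairPMF (mixWeight P (setPenalty ψ E x.1.1) (setPenalty ψ E x.1.2)) x.2.1 x.2.2 ∧
      (x.2.1.Nonempty ∧ x.2.1 ⊆ E) ∧ (x.2.2.Nonempty ∧ x.2.2 ⊆ E) ∧
      (x.2.1 ⊆ x.2.2 ∨ x.2.2 ⊆ x.2.1)) ∧
    (q'.expect fun C => ENNReal.ofReal (setPenalty ψ E C)) ≤
      q.expect fun C => ENNReal.ofReal (setPenalty ψ E C)}

/-- The weight is fixed by the penalties of one pair of sets and the support by another pair; action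
values do not enter, so there are only finitely many possibilities. -/
lemma finite_candidates [DecidableEq A] (ψ : A → ℚ≥0) (E : Finset A) (q : PMF (Finset A)) :
    (candidates ψ E q).Finite := by
  refine (Set.finite_range fun x : (Finset A × Finset A) × Finset A × Finset A =>
    pairPMF (mixWeight (q.expect fun C => ENNReal.ofReal (setPenalty ψ E C)).toReal
      (setPenalty ψ E x.1.1) (setPenalty ψ E x.1.2)) x.2.1 x.2.2).subset ?_
  rintro q' ⟨⟨x, rfl, -⟩, -⟩
  exact ⟨x, rfl⟩

/-- For all action values, some candidate distribution is at least as good as `q`. -/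
lemma exists_candidate_ge [DecidableEq A] (ψ : A → ℚ≥0) (E : Finset A) (q : PMF (Finset A))
    (hne : ∀ C ∈ q.support, C.Nonempty) (hE : ∀ C ∈ q.support, C ⊆ E) {v : A → ℝ≥0∞}
    (hv : ∀ a, v a ≠ ∞) :
    ∃ q' ∈ candidates ψ E q,
      (q.expect fun C => C.inf v) ≤ q'.expect fun C => C.inf v := by
  -- The infimum over the empty set is `∞`; nonemptiness on the support makes passage to real
  -- numbers possible.
  have hinf : ∀ C : Finset A, C.Nonempty → C.inf v ≠ ∞ := by
    rintro C ⟨a, ha⟩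
    exact ((Finset.inf_le ha).trans_lt (hv a).lt_top).ne
  set P := (q.expect fun C => ENNReal.ofReal (setPenalty ψ E C)).toReal with hP
  have hPtop : (q.expect fun C => ENNReal.ofReal (setPenalty ψ E C)) ≠ ∞ :=
    PMF.expect_ne_top _ fun _ _ => ENNReal.ofReal_ne_top
  have hsum : ∑ C, (q C).toReal = 1 := by
    rw [← ENNReal.toReal_sum fun C _ => q.apply_ne_top C, ← tsum_fintype (L := .unconditional _),
      q.tsum_coe,
      ENNReal.toReal_one]
  have hpen : ∑ C, (q C).toReal * setPenalty ψ E C = P := by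
    rw [hP, ← sum_toReal_mul_eq_toReal_expect _ fun _ _ => ENNReal.ofReal_ne_top]
    simp only [ENNReal.toReal_ofReal (setPenalty_nonneg ψ E _)]
  obtain ⟨C₁, C₂, h₁, h₂, hle, hval⟩ := exists_mixWeight_le (w := fun C => (C.inf v).toReal)
    (fun C => ENNReal.toReal_nonneg) hsum hpen
  have hsupp : ∀ C, 0 < (q C).toReal → C ∈ q.support := fun C h => by
    rw [PMF.mem_support_iff]
    rintro h'
    simp [h'] at h
  set t := mixWeight P (setPenalty ψ E C₁) (setPenalty ψ E C₂) with ht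
  have ht0 : 0 ≤ t := mixWeight_nonneg hle _
  have ht1 : t ≤ 1 := mixWeight_le_one hle _
  -- Upper level sets of `v` are nested. Passing from `C` to `up C` adds only actions of value at
  -- least `C.inf v`, so the infimum does not drop and the penalty does not rise.
  set up : Finset A → Finset A := fun C => E.filter fun a => C.inf v ≤ v a with hup
  have hsub : ∀ C, C ⊆ E → C ⊆ up C := fun C hC a ha =>
    Finset.mem_filter.2 ⟨hC ha, Finset.inf_le ha⟩
  have hupinf : ∀ C, C.inf v ≤ (up C).inf v := fun C =>
    Finset.le_inf fun a ha => (Finset.mem_filter.1 ha).2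
  have hs₁ := hsupp _ h₁
  have hs₂ := hsupp _ h₂
  -- The weight stays the one computed from `C₁` and `C₂`, for which `hval` holds, although the
  -- support now consists of the enlarged sets.
  refine ⟨pairPMF t (up C₁) (up C₂), ⟨⟨((C₁, C₂), up C₁, up C₂), rfl,
    ⟨(hne _ hs₁).mono (hsub _ (hE _ hs₁)), Finset.filter_subset _ _⟩,
    ⟨(hne _ hs₂).mono (hsub _ (hE _ hs₂)), Finset.filter_subset _ _⟩, ?_⟩, ?_⟩, ?_⟩
  · rcases le_total (C₁.inf v) (C₂.inf v) with h | h
    · exact Or.inr (Finset.monotone_filter_right _ fun a _ ha => h.trans ha)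
    · exact Or.inl (Finset.monotone_filter_right _ fun a _ ha => h.trans ha)
  · rw [expect_pairPMF ht0 ht1, ← ENNReal.ofReal_mul ht0, ← ENNReal.ofReal_mul (by linarith),
      ← ENNReal.ofReal_add (mul_nonneg ht0 (setPenalty_nonneg _ _ _))
        (mul_nonneg (by linarith) (setPenalty_nonneg _ _ _)),
      ← ENNReal.ofReal_toReal hPtop]
    refine ENNReal.ofReal_le_ofReal (le_trans ?_ (mixWeight_penalty_le hle (setPenalty ψ E C₂)))
    have a₁ := setPenalty_anti ψ E (hsub _ (hE _ hs₁))
    have a₂ := setPenalty_anti ψ E (hsub _ (hE _ hs₂))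
    have : 0 ≤ 1 - t := by linarith
    gcongr
  · calc (q.expect fun C => C.inf v) = ENNReal.ofReal (q.expect fun C => C.inf v).toReal :=
        (ENNReal.ofReal_toReal (PMF.expect_ne_top _ fun C hC => hinf C (hne C hC))).symm
      _ ≤ ENNReal.ofReal (t * (C₁.inf v).toReal + (1 - t) * (C₂.inf v).toReal) := by
        rw [← sum_toReal_mul_eq_toReal_expect _ fun C hC => hinf C (hne C hC)]
        exact ENNReal.ofReal_le_ofReal hval
      _ = ENNReal.ofReal t * C₁.inf v + ENNReal.ofReal (1 - t) * C₂.inf v := by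
        rw [ENNReal.ofReal_add (mul_nonneg ht0 ENNReal.toReal_nonneg)
          (mul_nonneg (by linarith) ENNReal.toReal_nonneg), ENNReal.ofReal_mul ht0,
          ENNReal.ofReal_mul (by linarith), ENNReal.ofReal_toReal (hinf _ (hne _ hs₁)),
          ENNReal.ofReal_toReal (hinf _ (hne _ hs₂))]
      _ ≤ _ := by
        rw [expect_pairPMF ht0 ht1]
        exact add_le_add (mul_le_mul_right (hupinf C₁) _) (mul_le_mul_right (hupinf C₂) _)

/-! ### One choice of candidates for discounts tending to 1 -/

variable {G : StochasticGame D B A}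

lemma localPenalty_eq [DecidableEq A] (θ : G.MultiStrategy) (ψ : D → A → ℚ≥0) (s : D) :
    θ.localPenalty ψ s = ((θ.choose s).expect fun C =>
      ENNReal.ofReal (setPenalty (ψ s) (G.enabled (Sum.inl s)) C)).toReal := by
  rw [← sum_toReal_mul_eq_toReal_expect _ fun _ _ => ENNReal.ofReal_ne_top,
    MultiStrategy.localPenalty]
  simp only [ENNReal.toReal_ofReal (setPenalty_nonneg _ _ _), ← Finset.mul_sum]
  refine Finset.sum_subset (Finset.subset_univ _) fun C _ hC => ?_
  have : θ.choose s C = 0 := by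
    rw [PMF.apply_eq_zero_iff]
    exact fun h => hC (Finset.mem_powerset.2 (θ.subset_enabled s C h))
  simp [this]

/-- The multi-strategy given by a choice of candidates. -/
noncomputable def candidateStrategy [DecidableEq A] (θ : G.MultiStrategy) (ψ : D → A → ℚ≥0)
    (q : D → PMF (Finset A))
    (hq : ∀ s, q s ∈ candidates (ψ s) (G.enabled (Sum.inl s)) (θ.choose s)) :
    G.MultiStrategy where
  choose := q
  nonempty s C hC := by
    obtain ⟨⟨x, hx, h1, h2, -⟩, -⟩ := hq s
    rw [hx] at hC
    rcases support_pairPMF_subset _ _ _ hC with rfl | rfl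
    exacts [h1.1, h2.1]
  subset_enabled s C hC := by
    obtain ⟨⟨x, hx, h1, h2, -⟩, -⟩ := hq s
    rw [hx] at hC
    rcases support_pairPMF_subset _ _ _ hC with rfl | rfl
    exacts [h1.2, h2.2]

lemma exists_sound_candidateStrategy [DecidableEq A]
    (hB : ∀ s : B, (G.enabled (Sum.inr s)).Nonempty) {r : D ⊕ B → A → ℚ≥0}
    (hr : G.FiniteMaxReward r) {b : ℝ} (ψ : D → A → ℚ≥0) {θ : G.MultiStrategy}
    (hθ : θ.Sound r b) :
    ∃ (q : D → PMF (Finset A))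
      (hq : ∀ s, q s ∈ candidates (ψ s) (G.enabled (Sum.inl s)) (θ.choose s)),
      (candidateStrategy θ ψ q hq).Sound r b := by
  obtain ⟨c, hmono, hlt, hlim⟩ := exists_seq_strictMono_tendsto' (zero_lt_one' ℝ≥0∞)
  have hfin : ∀ n s, discountedValue θ r (c n) s ≠ ∞ := fun n =>
    discountedValue_ne_top hB hr θ (hlt n).2.le
  have hex : ∀ n s, ∃ q ∈ candidates (ψ s) (G.enabled (Sum.inl s)) (θ.choose s),
      bellman θ r (discountedValue θ r (c n)) (Sum.inl s) ≤
        q.expect fun C => C.inf (G.actionValue r (discountedValue θ r (c n)) (Sum.inl s)) :=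
    fun n s => exists_candidate_ge _ _ _ (θ.nonempty s) (θ.subset_enabled s)
      (actionValue_ne_top r (hfin n) _)
  choose Q hQ hQle using hex
  have hF : (Set.pi Set.univ fun s =>
      candidates (ψ s) (G.enabled (Sum.inl s)) (θ.choose s)).Finite :=
    Set.Finite.pi fun s => finite_candidates _ _ _
  -- Pigeonhole: if each of the finitely many choices were eventually avoided, some `Q n` would
  -- differ from all of them, itself included.
  obtain ⟨q, hq, hfreq⟩ : ∃ q ∈ Set.pi Set.univ fun s =>
      candidates (ψ s) (G.enabled (Sum.inl s)) (θ.choose s), ∃ᶠ n in Filter.atTop, Q n = q := by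
    by_contra! h
    obtain ⟨n, hn⟩ := ((Filter.eventually_all_finite hF).2 h).exists
    exact hn (Q n) (fun s _ => hQ n s) rfl
  refine ⟨q, fun s => hq s trivial, fun σ hσ π => ?_⟩
  refine (ofReal_le_iSup_discountedValue hB hθ hmono.monotone hlim).trans (iSup_le fun n => ?_)
  -- Discounted values increase with the discount, so the bound at `n` follows from the one at a
  -- later `m` where `q` is the selected choice.
  obtain ⟨m, hnm, hm⟩ := hfreq.forall_exists_of_atTop n
  refine (discountedValue_mono θ r (hmono.monotone hnm) _).trans ?_
  refine le_expectedReward (hlt m).2 (hfin m) (fun s => ?_) G.init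
  rw [← discountedValue_eq]
  gcongr
  -- The operator of the new multi-strategy dominates that of `θ` at this discounted value: by
  -- choice of `q` at controller states, and with equality at environment states.
  refine le_trans ?_ (bellman_le_policyStep hσ π r _ s)
  rcases s with s | s
  · exact hm ▸ hQle m s
  · exact le_rfl

end StochasticGame

open StochasticGame in
theorem mainTheorem10 {D B A : Type*} [Fintype D] [Fintype B] [Fintype A] [DecidableEq A]
    (G : StochasticGame D B A) (r : D ⊕ B → A → ℚ≥0) (hr : G.FiniteMaxReward r) (b : ℝ)
    (ψ : D → A → ℚ≥0) (θ : G.MultiStrategy) (hθ : θ.Sound r b) :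
    ∃ θ' : G.MultiStrategy, θ'.Sound r b ∧ θ'.staticPenalty ψ ≤ θ.staticPenalty ψ ∧
      ∀ s : D, (θ'.choose s).support.encard ≤ 2 ∧
        ∀ C₁ ∈ (θ'.choose s).support, ∀ C₂ ∈ (θ'.choose s).support, C₁ ⊆ C₂ ∨ C₂ ⊆ C₁ := by
  by_cases hB : ∀ s : B, (G.enabled (Sum.inr s)).Nonempty
  · obtain ⟨q, hq, hsound⟩ := exists_sound_candidateStrategy hB hr ψ hθ
    refine ⟨_, hsound, Finset.sum_le_sum fun s _ => ?_, fun s => ?_⟩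
    · rw [localPenalty_eq, localPenalty_eq]
      exact ENNReal.toReal_mono (PMF.expect_ne_top _ fun _ _ => ENNReal.ofReal_ne_top) (hq s).2
    · obtain ⟨⟨x, hx, -, -, hchain⟩, -⟩ := hq s
      change (q s).support.encard ≤ 2 ∧ ∀ C₁ ∈ (q s).support, ∀ C₂ ∈ (q s).support, _
      rw [hx]
      refine ⟨(Set.encard_le_encard (support_pairPMF_subset _ _ _)).trans
        ((Set.encard_insert_le _ _).trans (by simp [one_add_one_eq_two])), fun C₁ h₁ C₂ h₂ => ?_⟩
      rcases support_pairPMF_subset _ _ _ h₁ with rfl | rfl <;>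
        rcases support_pairPMF_subset _ _ _ h₂ with rfl | rfl
      exacts [Or.inl subset_rfl, hchain, hchain.symm, Or.inl subset_rfl]
  -- An environment state without enabled actions rules out every environment strategy, so soundness
  -- is vacuous; allowing all enabled actions has penalty zero.
  · push Not at hB
    obtain ⟨s₀, hs₀⟩ := hB
    have hpi : ∀ π : G.BoxStrategy, False := fun π => by
      obtain ⟨a, ha⟩ := (π.choose s₀).support_nonempty
      simpa [hs₀] using π.mem_enabled s₀ a ha
    have hE : ∀ s : D, (G.enabled (Sum.inl s)).Nonempty := fun s => by
      obtain ⟨C, hC⟩ := (θ.choose s).support_nonempty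
      exact (θ.nonempty s C hC).mono (θ.subset_enabled s C hC)
    refine ⟨⟨fun s => PMF.pure (G.enabled (Sum.inl s)), fun s C hC => ?_, fun s C hC => ?_⟩,
      fun σ _ π => (hpi π).elim, Finset.sum_le_sum fun s _ => ?_, fun s => ?_⟩
    · rw [PMF.mem_support_pure_iff] at hC
      exact hC ▸ hE s
    · rw [PMF.mem_support_pure_iff] at hC
      exact hC.le
    · rw [localPenalty_eq, localPenalty_eq, PMF.expect_pure]
      simp [setPenalty]
    · simp [PMF.support_pure, Set.encard_singleton]
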